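/- Let $p$ be a prime, $n$ a positive integer, $q = p^n$, and let $\mathbb{F}_q$ be a field with $q$ elements. A polynomial $P \in \mathbb{F}_q[X]$ is called planar over $\mathbb{F}_q$ if for every non-zero $\alpha \in \mathbb{F}_q$ the map $x \mapsto P(x+\alpha) - P(x) - P(\alpha)$ is a permutation of $\mathbb{F}_q$. For a non-negative integer $e$, let $s_p(e)$ denote the sum of the digits of $e$ in base $p$. For $e, d \in \{0,1,\dots,q-1\}$ let $r$ be the unique integer with $0 \le r < q-1$ and $r \equiv ed \pmod{q-1}$, and define \[ e \star d = \begin{cases} 0 & \text{if } e = 0 \text{ or } d = 0,\\ q-1 & \text{if } e, d \neq 0 \text{ and } r = 0,\\ r & \text{if } e, d \neq 0 \text{ and } r \neq 0. \end{cases} \] If $0 \le d \le q-1$ and the monomial $X^d$ is planar over $\mathbb{F}_q$, then \[ s_p(e \star d) - s_p(e) \le \frac{n(p-1)}{2} \qquad \text{for all } e \in \{0,1,\dots,q-1\}. \] -/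

import Mathlib

/-- A function `f` on a field is planar if `x ↦ f (x + α) - f x - f α` is a permutation for every
non-zero `α`. -/
def IsPlanar {K : Type*} [Field K] (f : K → K) : Prop :=
  ∀ α : K, α ≠ 0 → Function.Bijective fun x : K => f (x + α) - f x - f α

/-- A polynomial is planar if its evaluation map is planar. -/
def Polynomial.IsPlanar {K : Type*} [Field K] (P : Polynomial K) : Prop :=
  _root_.IsPlanar fun x : K => P.eval x

/-- The sum `s_p(e)` of the digits of `e` in base `p`. -/
def digitSum (p e : ℕ) : ℕ := (Nat.digits p e).sum

/-- The operation `e ⋆ d` on `{0, …, q - 1}`: it is `0` if `e` or `d` is `0`, and otherwise the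
representative of `e * d` modulo `q - 1` in `{1, …, q - 1}`. -/
def starMul (q e d : ℕ) : ℕ :=
  if e = 0 ∨ d = 0 then 0
  else if e * d % (q - 1) = 0 then q - 1
  else e * d % (q - 1)

/-! For planar `f` and `a ≠ 0`, the exponential sum of `a * f x + b * x` times its complex conjugate
equals `q`. As `p` is totally ramified in the `p`-th cyclotomic field, the sum has exact order `n *
(p - 1) / 2` at `ζ - 1`, whatever `a ≠ 0` and `b` are (`associated_walshSum_sq`). For `f = X^d`, a
Mellin transform of these sums is `q - 1` times a product of two Gauss sums
(`sum_mul_walshSum_pow`), whose order is therefore at least `n * (p - 1) / 2`. For the inverse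
Teichmüller character `χ`, the Gauss sum of `χ ^ m` has order at most `s_p(m)`, the easy half of
Stickelberger's theorem (`Valuation.gaussSum_pow_digitSum_le`). Taking exponents `e` and `c = q - 1
- e ⋆ d` gives `s_p(e) + s_p(c) ≥ n * (p - 1) / 2`, and complementing digits turns this into the
claim. Valuations are multiplicative here, so upper bounds on orders appear as lower bounds on
values. -/

theorem digitSum_zero (p : ℕ) : digitSum p 0 = 0 := by
  simp [digitSum]

theorem digitSum_eq_mod_add_digitSum_div {p : ℕ} (hp : 1 < p) (m : ℕ) :
    digitSum p m = m % p + digitSum p (m / p) := by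
  rcases Nat.eq_zero_or_pos m with rfl | hm
  · simp [digitSum]
  · simp [digitSum, Nat.digits_def' hp hm]

theorem digitSum_add_mul {p : ℕ} (hp : 1 < p) {a : ℕ} (ha : a < p) (m : ℕ) :
    digitSum p (a + p * m) = a + digitSum p m := by
  rw [digitSum_eq_mod_add_digitSum_div hp, Nat.add_mul_mod_self_left, Nat.mod_eq_of_lt ha,
    Nat.add_mul_div_left _ _ (by omega), Nat.div_eq_of_lt ha, zero_add]

/-- Complementing all `n` base-`p` digits of `m < p ^ n`. -/
theorem digitSum_add_digitSum_compl {p : ℕ} (hp : 1 < p) (n : ℕ) :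
    ∀ m < p ^ n, digitSum p m + digitSum p (p ^ n - 1 - m) = n * (p - 1) := by
  induction n with
  | zero =>
    intro m hm
    obtain rfl : m = 0 := by simpa using hm
    simp [digitSum]
  | succ n ih =>
    intro m hm
    have hdiv : m / p < p ^ n := Nat.div_lt_of_lt_mul (by rwa [← pow_succ'])
    have hmod : m % p < p := Nat.mod_lt _ (by omega)
    have hm' : m % p + p * (m / p) = m := Nat.mod_add_div m p
    have hcompl : p ^ (n + 1) - 1 - m = (p - 1 - m % p) + p * (p ^ n - 1 - m / p) := by
      obtain ⟨c, hc⟩ := Nat.exists_eq_add_of_lt hdiv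
      obtain ⟨b, hb⟩ := Nat.exists_eq_add_of_lt hmod
      have h1 : p ^ n - 1 - m / p = c := by omega
      have h2 : p - 1 - m % p = b := by omega
      have h3 : p ^ (n + 1) = p * (m / p) + p * c + p := by rw [pow_succ', hc]; ring
      rw [h1, h2]
      omega
    rw [hcompl, digitSum_add_mul hp (by omega), digitSum_eq_mod_add_digitSum_div hp m]
    have := ih _ hdiv
    rw [Nat.add_mul]
    omega

/-! ### Exponential sums of planar functions and their Mellin transform. -/

section ExponentialSum

open Finset

variable {K A : Type*} [Field K] [Fintype K] [CommRing A] [IsDomain A]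

/-- The exponential sum of `x ↦ a * f x + b * x` with respect to `ψ`. -/
def walshSum (ψ : AddChar K A) (f : K → K) (a b : K) : A :=
  ∑ x, ψ (a * f x + b * x)

/-- Substituting `x = y + α` leaves, for each `α ≠ 0`, a nontrivial character summed over a
permutation of `K`, which vanishes; only `α = 0` contributes. -/
theorem walshSum_mul_walshSum_neg {ψ : AddChar K A} (hψ : ψ.IsPrimitive) {f : K → K}
    (hf : IsPlanar f) {a : K} (ha : a ≠ 0) (b : K) :
    walshSum ψ f a b * walshSum ψ f (-a) (-b) = Fintype.card K := by
  classical
  have hinner : ∀ α : K, ∑ y, ψ (a * f (y + α) + b * (y + α)) * ψ (-a * f y + -b * y) =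
      if α = 0 then (Fintype.card K : A) else 0 := by
    intro α
    simp_rw [← AddChar.map_add_eq_mul]
    split_ifs with hα
    · subst hα
      have h0 : ∀ y : K, a * f (y + 0) + b * (y + 0) + (-a * f y + -b * y) = 0 := by
        intro y; rw [add_zero]; ring
      simp only [h0, AddChar.map_zero_eq_one, sum_const, card_univ, nsmul_eq_mul, mul_one]
    · calc _ = ∑ y, ψ (a * f α + b * α) * ψ (a * (f (y + α) - f y - f α)) := by
            refine sum_congr rfl fun y _ => ?_
            rw [← AddChar.map_add_eq_mul]
            congr 1
            ring
        _ = ψ (a * f α + b * α) * ∑ y, AddChar.mulShift ψ a y := by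
            rw [← mul_sum]
            congr 1
            exact Fintype.sum_bijective _ (hf α hα) _ _ fun y => rfl
        _ = 0 := by rw [AddChar.sum_eq_zero_of_ne_one (hψ ha), mul_zero]
  calc walshSum ψ f a b * walshSum ψ f (-a) (-b)
      = ∑ y, ∑ x, ψ (a * f x + b * x) * ψ (-a * f y + -b * y) := by
        rw [walshSum, walshSum, sum_mul_sum, sum_comm]
    _ = ∑ y, ∑ α, ψ (a * f (y + α) + b * (y + α)) * ψ (-a * f y + -b * y) := by
        refine sum_congr rfl fun y _ => ?_
        exact (Fintype.sum_equiv (Equiv.addLeft y) _ _ fun α => rfl).symm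
    _ = Fintype.card K := by
        rw [sum_comm, sum_congr rfl fun α _ => hinner α, sum_ite_eq' univ (0 : K),
          if_pos (mem_univ _)]

/-- The Mellin transform of the exponential sums of `x ↦ a * x ^ d + b * x`. -/
theorem sum_mul_walshSum_pow (ψ : AddChar K A) {χ φ : MulChar K A} (hχ : χ ≠ 1) {d : ℕ}
    (hd : d ≠ 0) (h : χ ^ d * φ = 1) :
    ∑ a, ∑ b, χ a * φ b * walshSum ψ (· ^ d) a b =
      (Fintype.card K - 1) * (gaussSum χ ψ * gaussSum φ ψ) := by
  classical
  -- Rescaling both Gauss sums costs the factor `(χ ^ d * φ) x`, which is `1`, so every `x ≠ 0`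
  -- contributes the same.
  have hx : ∀ x : K, gaussSum χ (ψ.mulShift (x ^ d)) * gaussSum φ (ψ.mulShift x) =
      if x = 0 then 0 else gaussSum χ ψ * gaussSum φ ψ := by
    intro x
    split_ifs with hx0
    · subst hx0
      rw [zero_pow hd, AddChar.mulShift_zero, gaussSum_one_right hχ, zero_mul]
    · have h1 := gaussSum_mulShift χ ψ (Units.mk0 x hx0 ^ d)
      have h2 := gaussSum_mulShift φ ψ (Units.mk0 x hx0)
      have h3 : χ (x ^ d) * φ x = 1 := by
        have := congrArg (fun η : MulChar K A => η x) h
        simpa [MulChar.mul_apply, MulChar.pow_apply' _ hd, MulChar.one_apply, hx0] using this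
      simp only [Units.val_pow_eq_pow_val, Units.val_mk0] at h1 h2
      rw [← h1, ← h2, mul_mul_mul_comm, h3, one_mul]
  calc _ = ∑ x, gaussSum χ (ψ.mulShift (x ^ d)) * gaussSum φ (ψ.mulShift x) := by
        simp_rw [gaussSum, sum_mul_sum, walshSum, mul_sum]
        rw [sum_congr rfl fun a _ => sum_comm, sum_comm]
        refine sum_congr rfl fun x _ => sum_congr rfl fun a _ => sum_congr rfl fun b _ => ?_
        rw [AddChar.map_add_eq_mul, AddChar.mulShift_apply, AddChar.mulShift_apply,
          mul_comm (x ^ d), mul_comm x]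
        ring
    _ = _ := by
        simp_rw [hx]
        rw [sum_ite, sum_const_zero, zero_add, sum_const, nsmul_eq_mul, filter_ne',
          card_erase_of_mem (mem_univ _), card_univ, Nat.cast_pred Fintype.card_pos]

end ExponentialSum

/-! ### Total ramification in the cyclotomic field. -/

section Cyclotomic

open NumberField

/-- In the `p`-th cyclotomic field, `p` is totally ramified, so an element whose product with a
conjugate is a power of `p` has half the valuation of that power. -/
theorem associated_sq_of_mul_map_eq_pow {p : ℕ} [hp : Fact p.Prime] {C : Type*} [Field C]
    [NumberField C] [IsCyclotomicExtension {p} ℚ C] {ζ : C} (hζ : IsPrimitiveRoot ζ p)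
    (σ : C ≃+* C) {n : ℕ} {x : 𝓞 C}
    (hx : x * RingOfIntegers.mapRingEquiv σ x = (p : 𝓞 C) ^ n) :
    Associated (x ^ 2) ((hζ.toInteger - 1) ^ ((p - 1) * n)) := by
  have hprime : Prime (hζ.toInteger - 1) := hζ.zeta_sub_one_prime'
  have hpow : Associated (x * RingOfIntegers.mapRingEquiv σ x)
      ((hζ.toInteger - 1) ^ ((p - 1) * n)) := by
    rw [hx, pow_mul]
    exact ((IsCyclotomicExtension.Rat.associated_zeta_sub_one_pow_prime p hζ).pow_pow).symm
  obtain ⟨k, -, hk⟩ := (dvd_prime_pow hprime _).mp ((Dvd.intro _ rfl).trans hpow.dvd)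
  have hσ : Associated (RingOfIntegers.mapRingEquiv σ (hζ.toInteger - 1)) (hζ.toInteger - 1) := by
    have hη : IsPrimitiveRoot (σ ζ) p := hζ.map_of_injective σ.injective
    have : RingOfIntegers.mapRingEquiv σ (hζ.toInteger - 1) = hη.toInteger - 1 := by
      rw [map_sub, map_one]
      congr 1
    rw [this]
    exact IsCyclotomicExtension.Rat.associated_sub_one_of_isPrimitiveRoot p hη hζ
  have hconj : Associated (RingOfIntegers.mapRingEquiv σ x) x := by
    have h1 := hk.map (RingOfIntegers.mapRingEquiv σ)
    rw [map_pow] at h1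
    exact (h1.trans hσ.pow_pow).trans hk.symm
  rw [sq]
  exact ((Associated.refl x).mul_mul hconj.symm).trans hpow

end Cyclotomic

/-! ### The trace character and the Teichmüller character. -/

section TraceChar

variable {p : ℕ} [Fact p.Prime] (K : Type*) {A : Type*} [Field K]
  [Algebra (ZMod p) K] [CommRing A]

/-- The additive character `x ↦ ζ ^ Tr x` of a finite field of characteristic `p`. -/
noncomputable def traceChar {ζ : A} (hζ : ζ ^ p = 1) : AddChar K A :=
  (AddChar.zmodChar p hζ).compAddMonoidHom (Algebra.trace (ZMod p) K).toAddMonoidHom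

variable {K}

theorem traceChar_apply {ζ : A} (hζ : ζ ^ p = 1) (x : K) :
    traceChar K hζ x = ζ ^ (Algebra.trace (ZMod p) K x).val := rfl

theorem traceChar_pow_char [Finite K] {ζ : A} (hζ : ζ ^ p = 1) (x : K) :
    traceChar K hζ (x ^ p) = traceChar K hζ x := by
  have h := Algebra.trace_eq_of_algEquiv (FiniteField.frobeniusAlgEquivOfAlgebraic (ZMod p) K) x
  rw [FiniteField.coe_frobeniusAlgEquivOfAlgebraic, ZMod.card] at h
  rw [traceChar_apply, traceChar_apply, h]

theorem traceChar_isPrimitive [Finite K] {ζ : A} (hζ : IsPrimitiveRoot ζ p) :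
    (traceChar K hζ.pow_eq_one).IsPrimitive := by
  refine AddChar.IsPrimitive.of_ne_one (AddChar.ne_one_iff.2 ?_)
  obtain ⟨x, hx⟩ := Algebra.trace_surjective (ZMod p) K 1
  refine ⟨x, ?_⟩
  rw [traceChar_apply, hx, ZMod.val_one, pow_one]
  exact hζ.ne_one (Fact.out : p.Prime).one_lt

theorem map_traceChar {B : Type*} [CommRing B] (g : A →+* B) {ζ : A} (hζ : ζ ^ p = 1) {η : B}
    (hη : η ^ p = 1) (h : g ζ = η) (x : K) : g (traceChar K hζ x) = traceChar K hη x := by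
  rw [traceChar_apply, traceChar_apply, map_pow, h]

end TraceChar

section TeichmullerChar

open WittVector

variable {p : ℕ} [Fact p.Prime] {K L : Type*} [Field K] [Field L]

/-- The Teichmüller character of a field `K` of characteristic `p`, with values in a field that
receives the Witt vectors of `K`. -/
noncomputable def teichmullerChar (f : WittVector p K →+* L) : MulChar K L where
  toFun x := f (teichmuller p x)
  map_one' := by simp
  map_mul' x y := by simp
  map_nonunit' x hx := by
    rw [isUnit_iff_ne_zero, not_not] at hx
    simp [hx]

variable (f : WittVector p K →+* L)

theorem teichmullerChar_apply (x : K) : teichmullerChar f x = f (teichmuller p x) := rfl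

variable [CharP K p]

/-- Teichmüller lifts of distinct elements differ by a unit of the Witt vectors, which `f` cannot
kill. -/
theorem teichmullerChar_injective : Function.Injective (teichmullerChar f) := by
  intro x y hxy
  by_contra hne
  have hunit : IsUnit (teichmuller p x - teichmuller p y) := by
    refine isUnit_of_coeff_zero_ne_zero _ ?_
    change constantCoeff (teichmuller p x - teichmuller p y) ≠ 0
    rw [map_sub]
    exact sub_ne_zero.2 hne
  refine (hunit.map f).ne_zero ?_
  rw [map_sub]
  exact sub_eq_zero.2 hxy

theorem card_sub_one_dvd_of_inv_teichmullerChar_pow_eq_one [Fintype K] {e : ℕ}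
    (h : (teichmullerChar f)⁻¹ ^ e = 1) : Fintype.card K - 1 ∣ e := by
  rw [← FiniteField.forall_pow_eq_one_iff]
  intro x
  rw [inv_pow, inv_eq_one] at h
  have hx := congrArg (fun η : MulChar K L => η x) h
  simp only [MulChar.pow_apply_coe, MulChar.one_apply_coe, ← map_pow] at hx
  rw [Units.ext_iff, Units.val_pow_eq_pow_val, Units.val_one]
  exact teichmullerChar_injective f (hx.trans (map_one _).symm)

end TeichmullerChar

/-! ### Valuations of Gauss sums. -/

theorem Valuation.map_eq_one_of_pow_eq_one {L Γ : Type*} [Field L]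
    [LinearOrderedCommGroupWithZero Γ] (v : Valuation L Γ) {x : L} {m : ℕ} (hm : m ≠ 0)
    (h : x ^ m = 1) : v x = 1 := by
  have := congrArg v h
  rw [map_pow, map_one] at this
  exact (pow_eq_one_iff_of_nonneg zero_le hm).1 this

theorem Valuation.addChar_eq_one {K L Γ : Type*} [Field K] [Field L]
    [LinearOrderedCommGroupWithZero Γ] (v : Valuation L Γ) {p : ℕ} [Fact p.Prime] [CharP K p]
    (ψ : AddChar K L) (x : K) :
    v (ψ x) = 1 := by
  refine v.map_eq_one_of_pow_eq_one (m := p) (Fact.out : p.Prime).ne_zero ?_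
  rw [← AddChar.map_nsmul_eq_pow, nsmul_eq_mul, CharP.cast_eq_zero, zero_mul,
    AddChar.map_zero_eq_one]

section Valuation

variable {K L Γ : Type*} [Field K] [Fintype K] [Field L] [LinearOrderedCommGroupWithZero Γ]
  (v : Valuation L Γ)

theorem Valuation.mulChar_le_one (χ : MulChar K L) (x : K) : v (χ x) ≤ 1 := by
  by_cases hx : x = 0
  · rw [hx, MulChar.map_zero, map_zero]
    exact zero_le
  · refine (v.map_eq_one_of_pow_eq_one (m := Fintype.card K - 1) ?_ ?_).le
    · have := Fintype.one_lt_card (α := K)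
      omega
    · rw [← map_pow, FiniteField.pow_card_sub_one_eq_one x hx, map_one]

theorem Valuation.jacobiSum_le_one (χ φ : MulChar K L) : v (jacobiSum χ φ) ≤ 1 := by
  refine v.map_sum_le fun x _ => ?_
  rw [map_mul]
  exact mul_le_one' (v.mulChar_le_one χ x) (v.mulChar_le_one φ _)

theorem gaussSum_pow_char {p : ℕ} [Fact p.Prime] [CharP K p] {ψ : AddChar K L}
    (hψ : ∀ x, ψ (x ^ p) = ψ x) (χ : MulChar K L) : gaussSum (χ ^ p) ψ = gaussSum χ ψ := by
  have hp : p ≠ 0 := (Fact.out : p.Prime).ne_zero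
  refine Fintype.sum_bijective (fun x : K => x ^ p)
    (Finite.injective_iff_bijective.1 (frobenius_inj K p)) _ _ fun x => ?_
  rw [MulChar.pow_apply' χ hp, map_pow, hψ]

theorem Valuation.gaussSum_le_one (p : ℕ) [Fact p.Prime] [CharP K p] (χ : MulChar K L)
    (ψ : AddChar K L) : v (gaussSum χ ψ) ≤ 1 := by
  refine v.map_sum_le fun x _ => ?_
  rw [map_mul, v.addChar_eq_one (p := p), mul_one]
  exact v.mulChar_le_one χ x

/-- The quotient of the two sides is a Jacobi sum, which is integral, unless `χ * φ = 1`, when the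
right side is `v (-1) = 1`. -/
theorem Valuation.gaussSum_mul_gaussSum_le {p : ℕ} [Fact p.Prime] [CharP K p] {ψ : AddChar K L}
    (hψ : ψ ≠ 1) (χ φ : MulChar K L) :
    v (gaussSum χ ψ) * v (gaussSum φ ψ) ≤ v (gaussSum (χ * φ) ψ) := by
  by_cases h : χ * φ = 1
  · rw [h, gaussSum_one_left hψ, Valuation.map_neg, map_one]
    exact mul_le_one' (v.gaussSum_le_one p χ ψ) (v.gaussSum_le_one p φ ψ)
  · rw [← map_mul, ← jacobiSum_mul_nontrivial h ψ, map_mul]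
    exact mul_le_of_le_one_right' (v.jacobiSum_le_one χ φ)

theorem Valuation.gaussSum_pow_le {p : ℕ} [Fact p.Prime] [CharP K p] {ψ : AddChar K L}
    (hψ : ψ ≠ 1) (χ : MulChar K L) (m : ℕ) :
    v (gaussSum χ ψ) ^ m ≤ v (gaussSum (χ ^ m) ψ) := by
  induction m with
  | zero => simp [gaussSum_one_left hψ]
  | succ m ih =>
    rw [pow_succ, pow_succ]
    exact (mul_le_mul_left ih _).trans (v.gaussSum_mul_gaussSum_le (p := p) hψ _ _)

/-- The upper bound for the order of `p` in Gauss sums in terms of digit sums. -/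
theorem Valuation.gaussSum_pow_digitSum_le {p : ℕ} [hp : Fact p.Prime]
    [CharP K p] {ψ : AddChar K L} (hψ : ψ ≠ 1) (hfrob : ∀ x, ψ (x ^ p) = ψ x) (χ : MulChar K L)
    (e : ℕ) : v (gaussSum χ ψ) ^ digitSum p e ≤ v (gaussSum (χ ^ e) ψ) := by
  induction e using Nat.strong_induction_on with
  | _ e ih =>
    rcases Nat.eq_zero_or_pos e with rfl | he
    · simp [digitSum_zero, gaussSum_one_left hψ]
    · have hdiv := ih (e / p) (Nat.div_lt_self he hp.out.one_lt)
      -- Frobenius invariance makes the digit shift `e / p ↦ p * (e / p)` free.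
      rw [← gaussSum_pow_char hfrob (χ ^ (e / p)), ← pow_mul, mul_comm (e / p)] at hdiv
      rw [digitSum_eq_mod_add_digitSum_div hp.out.one_lt, pow_add]
      calc _ ≤ v (gaussSum (χ ^ (e % p)) ψ) * v (gaussSum (χ ^ (p * (e / p))) ψ) :=
            mul_le_mul' (v.gaussSum_pow_le (p := p) hψ χ _) hdiv
        _ ≤ _ := by
            have := v.gaussSum_mul_gaussSum_le (p := p) hψ (χ ^ (e % p)) (χ ^ (p * (e / p)))
            rwa [← pow_add, Nat.mod_add_div] at this

end Valuation

/-- Expand the trace as `∑ x ^ p ^ i`: the power sum with exponent `p ^ i - 1` over the units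
vanishes unless `i = 0`, where it is `q - 1 = -1`. -/
theorem sum_inv_mul_trace {p : ℕ} [Fact p.Prime] (K : Type*) [Field K] [Fintype K]
    [Algebra (ZMod p) K] :
    ∑ x : K, x⁻¹ * algebraMap (ZMod p) K (Algebra.trace (ZMod p) K x) = -1 := by
  classical
  have hcard : Fintype.card K = p ^ Module.finrank (ZMod p) K := by
    simpa [ZMod.card] using Module.card_eq_pow_finrank (K := ZMod p) (V := K)
  have hp1 : 1 < p := (Fact.out : p.Prime).one_lt
  have hfin : 0 < Module.finrank (ZMod p) K := Module.finrank_pos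
  have hunits : ∀ i, ∑ x : K, x⁻¹ * x ^ p ^ i = ∑ x : Kˣ, (x ^ (p ^ i - 1) : K) := by
    intro i
    rw [← Finset.sum_subset (Finset.subset_univ (Finset.univ.erase (0 : K)))]
    · symm
      refine Finset.sum_bij (fun x _ => (x : K)) (by simp) (fun a _ b _ h => Units.ext h)
        (fun b hb => ⟨Units.mk0 b (Finset.ne_of_mem_erase hb), by simp, rfl⟩) fun x _ => ?_
      rw [pow_sub₀ _ x.ne_zero (Nat.one_le_pow _ _ (by omega)), pow_one, mul_comm]
    · intro x _ hx
      obtain rfl : x = 0 := by simpa using hx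
      simp
  simp_rw [FiniteField.algebraMap_trace_eq_sum_pow, Nat.card_zmod, Finset.mul_sum]
  rw [Finset.sum_comm]
  simp_rw [hunits, FiniteField.sum_pow_units, hcard]
  rw [Finset.sum_eq_single 0]
  · simp
  · intro i hi hi0
    rw [if_neg]
    intro hdvd
    have h1 : p ^ i < p ^ Module.finrank (ZMod p) K :=
      Nat.pow_lt_pow_right hp1 (Finset.mem_range.1 hi)
    have h2 : 1 < p ^ i := Nat.one_lt_pow hi0 hp1
    have := Nat.le_of_dvd (by omega) hdvd
    omega
  · intro h
    exact absurd (Finset.mem_range.2 hfin) h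

section

open WittVector

/-- The Gauss sum of the inverse Teichmüller character is divisible by `ζ - 1` exactly once. -/
theorem Valuation.gaussSum_inv_teichmullerChar {p : ℕ} [hp : Fact p.Prime] {K L Γ : Type*}
    [Field K] [Fintype K] [Algebra (ZMod p) K] [CharP K p] [Field L]
    [LinearOrderedCommGroupWithZero Γ] (v : Valuation L Γ) (f : WittVector p K →+* L)
    (hf : ∀ w, v (f w) ≤ 1) {ζ : L} (hζ : ζ ^ p = 1) (hv : v (ζ - 1) < 1)
    (hK : 2 < Fintype.card K) :
    v (gaussSum (teichmullerChar f)⁻¹ (traceChar K hζ)) = v (ζ - 1) := by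
  set χ := (teichmullerChar f)⁻¹ with hχ
  set t : K → ℕ := fun x => (Algebra.trace (ZMod p) K x).val with ht
  have hχ1 : χ ≠ 1 := by
    intro h
    have := Nat.le_of_dvd one_pos (card_sub_one_dvd_of_inv_teichmullerChar_pow_eq_one f
      (e := 1) (by rw [pow_one]; exact h))
    omega
  -- Subtract `∑ χ x = 0`, then factor each `ζ ^ t x - 1`.
  have hfactor : gaussSum χ (traceChar K hζ) =
      (ζ - 1) * ∑ x, χ x * ∑ j ∈ Finset.range (t x), ζ ^ j := by
    calc _ = ∑ x, χ x * ζ ^ t x - ∑ x, χ x := by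
          rw [MulChar.sum_eq_zero_of_ne_one hχ1, sub_zero]
          rfl
      _ = _ := by
          rw [← Finset.sum_sub_distrib, Finset.mul_sum]
          refine Finset.sum_congr rfl fun x _ => ?_
          rw [mul_left_comm, mul_geom_sum]
          ring
  have hvζ : v ζ = 1 := v.map_eq_one_of_pow_eq_one hp.out.ne_zero hζ
  have hgeom : ∀ j : ℕ, v (ζ ^ j - 1) < 1 := by
    intro j
    rw [← mul_geom_sum, map_mul]
    refine mul_lt_one_of_lt_of_le hv (v.map_sum_le fun i _ => ?_)
    rw [map_pow, hvζ, one_pow]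
  -- Modulo `ζ - 1` each geometric sum is `t x`, so the cofactor is congruent to `f w`; the residue
  -- of `w` is the trace sum `-1`, hence `w` is a unit.
  set w : WittVector p K := ∑ x, teichmuller p x⁻¹ * (t x : WittVector p K) with hw
  have hfw : f w = ∑ x, χ x * ∑ j ∈ Finset.range (t x), (1 : L) := by
    rw [hw, map_sum]
    refine Finset.sum_congr rfl fun x _ => ?_
    rw [hχ, MulChar.inv_apply', teichmullerChar_apply]
    simp
  have hunit : IsUnit w := by
    refine isUnit_of_coeff_zero_ne_zero _ ?_
    have hcoeff : constantCoeff w = (-1 : K) := by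
      rw [hw, map_sum, ← sum_inv_mul_trace (p := p) K]
      refine Finset.sum_congr rfl fun x _ => ?_
      rw [map_mul, map_natCast]
      congr 1
      rw [ht, ← map_natCast (algebraMap (ZMod p) K), ZMod.natCast_val, ZMod.cast_id', id]
    change constantCoeff w ≠ 0
    rw [hcoeff]
    exact neg_ne_zero.2 one_ne_zero
  have hvw : v (f w) = 1 := by
    obtain ⟨u, hu⟩ := hunit
    refine le_antisymm (hf w) ?_
    have h1 : v (f w) * v (f (↑u⁻¹ : WittVector p K)) = 1 := by
      rw [← map_mul, ← map_mul, ← hu, Units.mul_inv, map_one, map_one]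
    rw [← h1]
    exact mul_le_of_le_one_right' (hf _)
  rw [hfactor, map_mul]
  suffices h : v (∑ x, χ x * ∑ j ∈ Finset.range (t x), ζ ^ j) = 1 by rw [h, mul_one]
  rw [← hvw]
  refine v.map_eq_of_sub_lt ?_
  rw [hvw, hfw, ← Finset.sum_sub_distrib]
  refine v.map_sum_lt one_ne_zero fun x _ => ?_
  rw [← mul_sub, ← Finset.sum_sub_distrib, map_mul]
  exact (mul_le_of_le_one_left' (v.mulChar_le_one χ x)).trans_lt
    (v.map_sum_lt one_ne_zero fun j _ => hgeom j)

end

/-! ### A valued field containing the Witt vectors. -/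

section

open WittVector

variable (p : ℕ) [hp : Fact p.Prime] (K : Type*) [Field K] [CharP K p]

theorem WittVector.charZero_of_charP : CharZero (WittVector p K) := by
  obtain ⟨c, hc⟩ := CharP.exists (WittVector p K)
  rcases CharP.char_is_prime_or_zero (WittVector p K) c with h | rfl
  · exfalso
    have h0 : (c : K) = 0 := by
      have := congrArg constantCoeff (CharP.cast_eq_zero (WittVector p K) c)
      rwa [map_natCast, map_zero] at this
    obtain rfl : p = c :=
      (Nat.prime_dvd_prime_iff_eq hp.out h).1 ((CharP.cast_eq_zero_iff K p c).1 h0)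
    exact p_nonzero p K (CharP.cast_eq_zero (WittVector p K) p)
  · exact CharP.charP_to_charZero _

/-- The Witt vectors of a finite field embed into the valuation ring of an algebraically closed
valued field of characteristic zero in which `p` is not a unit. -/
theorem WittVector.exists_valuationSubring_algebraicClosure [Finite K] :
    ∃ V : ValuationSubring (AlgebraicClosure (FractionRing (WittVector p K))),
      (∀ w : WittVector p K, V.valuation (algebraMap _ _ w) ≤ 1) ∧ V.valuation (p : _) < 1 := by
  obtain ⟨V, hV, hlocal⟩ := IsLocalRing.exists_factor_valuationRing
    (algebraMap (WittVector p K) (AlgebraicClosure (FractionRing (WittVector p K))))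
  refine ⟨V, fun w => (V.valuation_le_one_iff _).2 (hV w), ?_⟩
  have hle := (V.valuation_le_one_iff _).2 (hV p)
  rw [map_natCast] at hle
  refine lt_of_le_of_ne hle fun h => ?_
  have hmem : (p : AlgebraicClosure (FractionRing (WittVector p K))) ∈ V := natCast_mem V p
  have hunit : IsUnit (⟨p, hmem⟩ : V) := (V.valuation_eq_one_iff _).2 h
  -- The map to `V` is local, so it reflects units.
  refine (WittVector.irreducible p (k := K)).not_isUnit (hlocal.map_nonunit _ ?_)
  convert! hunit using 1
  exact Subtype.ext (map_natCast _ p)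

end

/-! ### Assembling the bound. -/

theorem starMul_le {q : ℕ} (hq : 1 < q) (e d : ℕ) : starMul q e d ≤ q - 1 := by
  have := Nat.mod_lt (e * d) (show 0 < q - 1 by omega)
  unfold starMul
  split_ifs <;> omega

theorem sub_one_dvd_mul_add_compl_starMul {q : ℕ} (hq : 1 < q) (e d : ℕ) :
    q - 1 ∣ e * d + (q - 1 - starMul q e d) := by
  have hlt := Nat.mod_lt (e * d) (show 0 < q - 1 by omega)
  unfold starMul
  split_ifs with h h0
  · rcases h with rfl | rfl <;> simp
  · simpa using Nat.dvd_of_mod_eq_zero h0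
  · rw [← Nat.add_sub_assoc hlt.le, Nat.add_comm, Nat.add_sub_assoc (Nat.mod_le _ _)]
    exact dvd_add dvd_rfl (Nat.dvd_sub_mod _)

section

open NumberField

variable {p : ℕ} [hp : Fact p.Prime] {K : Type*} [Field K] [Fintype K] [Algebra (ZMod p) K]

/-- Over the `p`-th cyclotomic integers, the exponential sums of a planar function have half the
valuation of the order of the field. -/
theorem associated_walshSum_sq {C : Type*} [Field C] [NumberField C]
    [IsCyclotomicExtension {p} ℚ C] {ζ : C} (hζ : IsPrimitiveRoot ζ p) {n : ℕ}
    (hK : Fintype.card K = p ^ n) {f : K → K} (hf : IsPlanar f) {a : K} (ha : a ≠ 0) (b : K) :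
    Associated (walshSum (traceChar K hζ.toInteger_isPrimitiveRoot.pow_eq_one) f a b ^ 2)
      ((hζ.toInteger - 1) ^ ((p - 1) * n)) := by
  set ψ := traceChar K hζ.toInteger_isPrimitiveRoot.pow_eq_one with hψ
  obtain ⟨σ, hσ⟩ : ∃ σ : C ≃ₐ[ℚ] C, σ ζ = ζ⁻¹ := by
    have hirr := Polynomial.cyclotomic.irreducible_rat hp.out.pos
    have hmin : minpoly ℚ (hζ.powerBasis ℚ).gen = minpoly ℚ (hζ.inv.powerBasis ℚ).gen := by
      rw [hζ.powerBasis_gen ℚ, hζ.inv.powerBasis_gen ℚ,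
        ← hζ.minpoly_eq_cyclotomic_of_irreducible (K := ℚ) hirr,
        ← hζ.inv.minpoly_eq_cyclotomic_of_irreducible (K := ℚ) hirr]
    refine ⟨(hζ.powerBasis ℚ).equivOfMinpoly (hζ.inv.powerBasis ℚ) hmin, ?_⟩
    have := (hζ.powerBasis ℚ).equivOfMinpoly_gen (hζ.inv.powerBasis ℚ) hmin
    rwa [hζ.powerBasis_gen ℚ, hζ.inv.powerBasis_gen ℚ] at this
  refine associated_sq_of_mul_map_eq_pow hζ (σ : C ≃+* C) (n := n) ?_
  have hconj : ∀ x, RingOfIntegers.mapRingEquiv (σ : C ≃+* C) (ψ x) = ψ (-x) := by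
    intro x
    have hcoe : ∀ y, (ψ y : C) = ζ ^ (Algebra.trace (ZMod p) K y).val := by
      intro y
      rw [hψ, traceChar_apply]
      rfl
    have hmul : ψ x * ψ (-x) = 1 := by
      rw [← AddChar.map_add_eq_mul, add_neg_cancel, AddChar.map_zero_eq_one]
    have hmul' : (ψ x : C) * (ψ (-x) : C) = 1 := by
      rw [← map_mul, hmul, map_one]
    refine RingOfIntegers.ext ?_
    change σ (ψ x : C) = (ψ (-x) : C)
    rw [eq_inv_of_mul_eq_one_right hmul', hcoe, map_pow, hσ, inv_pow]
  have hmap : RingOfIntegers.mapRingEquiv (σ : C ≃+* C) (walshSum ψ f a b) =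
      walshSum ψ f (-a) (-b) := by
    rw [walshSum, walshSum, map_sum]
    refine Finset.sum_congr rfl fun x _ => ?_
    rw [hconj]
    congr 1
    ring
  rw [hmap, walshSum_mul_walshSum_neg (traceChar_isPrimitive hζ.toInteger_isPrimitiveRoot) hf ha,
    hK, Nat.cast_pow]

theorem map_walshSum {A B : Type*} [CommRing A] [CommRing B] (g : A →+* B)
    {ζ : A} (hζ : ζ ^ p = 1) {η : B} (hη : η ^ p = 1) (h : g ζ = η) (f : K → K) (a b : K) :
    g (walshSum (traceChar K hζ) f a b) = walshSum (traceChar K hη) f a b := by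
  rw [walshSum, walshSum, map_sum]
  exact Finset.sum_congr rfl fun x _ => map_traceChar g hζ hη h _

end

/-- Valuation rings are integrally closed, so integral elements have value at most `1` and
divisibility bounds values both ways. -/
theorem ValuationSubring.valuation_eq_of_associated {L R : Type*} [Field L] (V : ValuationSubring L)
    [CommRing R] [Algebra.IsIntegral ℤ R] (g : R →+* L) {x y : R} (h : Associated x y) :
    V.valuation (g x) = V.valuation (g y) := by
  have hle : ∀ r : R, V.valuation (g r) ≤ 1 := by
    intro r
    have hr : IsIntegral ℤ (g r) := map_isIntegral_int g (Algebra.IsIntegral.isIntegral r)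
    obtain ⟨y, hy⟩ := IsIntegrallyClosed.isIntegral_iff.1 (hr.tower_top (A := V))
    rw [← hy]
    exact V.valuation_le_one y
  have hdvd : ∀ {a b : R}, a ∣ b → V.valuation (g b) ≤ V.valuation (g a) := by
    rintro a _ ⟨c, rfl⟩
    rw [map_mul, map_mul]
    exact mul_le_of_le_one_right' (hle c)
  exact le_antisymm (hdvd h.symm.dvd) (hdvd h.dvd)

/-- A planar power map bounds the digit sums of an exponent and of its complementary multiple. -/
theorem IsPlanar.card_le_digitSum_add_digitSum {K : Type*} [Field K] [Fintype K] {p n : ℕ}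
    (hp : p.Prime) (hK : Fintype.card K = p ^ n) {d : ℕ} (hd : d ≠ 0)
    (hplanar : IsPlanar fun x : K => x ^ d) {e c : ℕ} (he : ¬ p ^ n - 1 ∣ e)
    (hc : p ^ n - 1 ∣ e * d + c) :
    (p - 1) * n ≤ 2 * (digitSum p e + digitSum p c) := by
  classical
  have : Fact p.Prime := ⟨hp⟩
  have : CharP K p := charP_of_card_eq_prime_pow hK
  let : Algebra (ZMod p) K := ZMod.algebra K p
  have := WittVector.charZero_of_charP p K
  obtain ⟨V, hV, hVp⟩ := WittVector.exists_valuationSubring_algebraicClosure p K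
  set L := AlgebraicClosure (FractionRing (WittVector p K))
  set f : WittVector p K →+* L := algebraMap _ _
  have : CharZero (FractionRing (WittVector p K)) :=
    charZero_of_injective_algebraMap (IsFractionRing.injective (WittVector p K) _)
  have : CharZero L :=
    charZero_of_injective_algebraMap (algebraMap (FractionRing (WittVector p K)) L).injective
  set v := V.valuation
  have : NeZero (p : ℚ) := ⟨Nat.cast_ne_zero.2 hp.ne_zero⟩
  let C := CyclotomicField p ℚ
  have : IsCyclotomicExtension {p} ℚ C := CyclotomicField.isCyclotomicExtension p ℚ
  have hζ : IsPrimitiveRoot (IsCyclotomicExtension.zeta p ℚ C) p :=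
    IsCyclotomicExtension.zeta_spec p ℚ C
  let j : C →ₐ[ℚ] L := IsAlgClosed.lift
  let g : NumberField.RingOfIntegers C →+* L :=
    (j : C →+* L).comp (algebraMap (NumberField.RingOfIntegers C) C)
  have hη : IsPrimitiveRoot (g hζ.toInteger) p := hζ.map_of_injective (f := j) j.injective
  set π : L := g hζ.toInteger - 1 with hπ
  have hgπ : g (hζ.toInteger - 1) = π := by rw [map_sub, map_one]
  have hπ0 : π ≠ 0 := sub_ne_zero.2 (hη.ne_one hp.one_lt)
  have hvπ0 : 0 < v π := (Valuation.pos_iff v).2 hπ0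
  have hvπ : v π < 1 := by
    have h := V.valuation_eq_of_associated g
      (IsCyclotomicExtension.Rat.associated_zeta_sub_one_pow_prime p hζ)
    rw [map_pow, hgπ, map_natCast, map_pow] at h
    by_contra hlt
    have := one_le_pow₀ (not_lt.1 hlt) (n := p - 1)
    rw [h] at this
    exact absurd hVp (not_lt.2 this)
  set ψ := traceChar K hη.pow_eq_one
  have hψ : ψ.IsPrimitive := traceChar_isPrimitive hη
  have hψ1 : ψ ≠ 1 := by
    have := hψ one_ne_zero
    rwa [AddChar.mulShift_one] at this
  have hwalsh : ∀ a b : K, a ≠ 0 → v (walshSum ψ (· ^ d) a b) ^ 2 = v π ^ ((p - 1) * n) := by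
    intro a b ha
    have h := V.valuation_eq_of_associated g (associated_walshSum_sq hζ hK hplanar ha b)
    rwa [map_pow, map_pow, map_pow, map_pow, hgπ, map_walshSum g _ hη.pow_eq_one rfl] at h
  set χ : MulChar K L := (teichmullerChar f)⁻¹
  have hχe : χ ^ e ≠ 1 := fun h =>
    he (hK ▸ card_sub_one_dvd_of_inv_teichmullerChar_pow_eq_one f h)
  have hχ : (χ ^ e) ^ d * χ ^ c = 1 := by
    obtain ⟨m, hm⟩ := hc
    rw [← pow_mul, ← pow_add, hm, ← hK, ← Fintype.card_units, pow_mul, MulChar.pow_card_eq_one,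
      one_pow]
  -- If `q = 2`, then `q - 1 = 1` divides `e`.
  have hcard : 2 < Fintype.card K := by
    have h1 := Fintype.one_lt_card (α := K)
    by_contra h2
    refine he ?_
    rw [← hK, show Fintype.card K - 1 = 1 by omega]
    exact one_dvd e
  have hgauss : v (gaussSum (χ ^ e) ψ) * v (gaussSum (χ ^ c) ψ) ≤ v (walshSum ψ (· ^ d) 1 0) := by
    have hunit : v (Fintype.card K - 1 : L) = 1 := by
      have hlt : v (Fintype.card K : L) < 1 := by
        rw [hK, Nat.cast_pow, map_pow]
        refine pow_lt_one₀ zero_le hVp ?_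
        rintro rfl
        simp [hK] at hcard
      rw [Valuation.map_sub_swap, v.map_one_sub_of_lt hlt]
    calc _ = v (∑ a, ∑ b, (χ ^ e) a * (χ ^ c) b * walshSum ψ (· ^ d) a b) := by
          rw [sum_mul_walshSum_pow ψ hχe hd hχ, map_mul, hunit, one_mul, map_mul]
      _ ≤ _ := by
          refine v.map_sum_le fun a _ => v.map_sum_le fun b _ => ?_
          rw [map_mul, map_mul]
          by_cases ha : a = 0
          · rw [ha, MulChar.map_zero, map_zero, zero_mul, zero_mul]
            exact zero_le
          · have heq : v (walshSum ψ (· ^ d) a b) = v (walshSum ψ (· ^ d) 1 0) :=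
              (pow_left_inj₀ zero_le zero_le two_ne_zero).1
                ((hwalsh a b ha).trans (hwalsh 1 0 one_ne_zero).symm)
            rw [heq]
            exact mul_le_of_le_one_left'
              (mul_le_one' (v.mulChar_le_one _ a) (v.mulChar_le_one _ b))
  have hfrob : ∀ x, ψ (x ^ p) = ψ x := traceChar_pow_char hη.pow_eq_one
  have hbase : v (gaussSum χ ψ) = v π :=
    v.gaussSum_inv_teichmullerChar f hV hη.pow_eq_one hvπ hcard
  have hdigits : ∀ m, v π ^ digitSum p m ≤ v (gaussSum (χ ^ m) ψ) := fun m =>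
    hbase ▸ v.gaussSum_pow_digitSum_le hψ1 hfrob χ m
  have hfinal : v π ^ (2 * (digitSum p e + digitSum p c)) ≤ v π ^ ((p - 1) * n) := by
    rw [← hwalsh 1 0 one_ne_zero, mul_comm 2, pow_mul, pow_add]
    exact pow_le_pow_left' ((mul_le_mul' (hdigits e) (hdigits c)).trans hgauss) 2
  exact (pow_le_pow_iff_right_of_lt_one₀ hvπ0 hvπ).1 hfinal

theorem corollary1 {K : Type*} [Field K] [Fintype K] (p n : ℕ) (hp : p.Prime) (hn : 0 < n)
    (hK : Fintype.card K = p ^ n) (d : ℕ) (hd : d ≤ p ^ n - 1)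
    (hplanar : ((Polynomial.X : Polynomial K) ^ d).IsPlanar)
    (e : ℕ) (he : e ≤ p ^ n - 1) :
    (digitSum p (starMul (p ^ n) e d) : ℝ) - (digitSum p e : ℝ) ≤ (n : ℝ) * ((p : ℝ) - 1) / 2 := by
  have hq : 1 < p ^ n := Nat.one_lt_pow hn.ne' hp.one_lt
  suffices h : 2 * digitSum p (starMul (p ^ n) e d) ≤ 2 * digitSum p e + n * (p - 1) by
    have h' : (2 * digitSum p (starMul (p ^ n) e d) : ℝ) ≤
        2 * digitSum p e + n * ((p : ℝ) - 1) := by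
      rw [← Nat.cast_pred hp.pos]
      exact_mod_cast h
    linarith
  by_cases hed : e = 0 ∨ d = 0
  · simp [starMul, hed, digitSum_zero]
  obtain ⟨he0, hd0⟩ := not_or.1 hed
  -- Here `χ ^ e` would be trivial; but then `e = q - 1` is fixed by `⋆ d`.
  by_cases hdvd : p ^ n - 1 ∣ e
  · have heq : e = p ^ n - 1 := le_antisymm he (Nat.le_of_dvd (Nat.pos_of_ne_zero he0) hdvd)
    have hstar : starMul (p ^ n) e d = e := by
      rw [starMul, if_neg hed, if_pos (Nat.mod_eq_zero_of_dvd (hdvd.mul_right d)), heq]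
    rw [hstar]
    exact Nat.le_add_right _ _
  · have hpl : IsPlanar fun x : K => x ^ d := by
      simpa [Polynomial.IsPlanar] using hplanar
    have hmain := hpl.card_le_digitSum_add_digitSum hp hK hd0 hdvd
      (sub_one_dvd_mul_add_compl_starMul hq e d)
    have hcompl := digitSum_add_digitSum_compl hp.one_lt n (starMul (p ^ n) e d)
      (by have := starMul_le hq e d; omega)
    rw [mul_comm (p - 1)] at hmain
    omega
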